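/- Let $\mathcal P=\langle X:\mathcal R\rangle$ be a group presentation, where $\mathcal R$ is a set of pairs $(l,r)$ of words, not necessarily freely reduced, in the alphabet $X\cup X^{-1}$ (words are also read as elements of the free group $F(X)$). For $s=(l,r)\in\mathcal R$ let $\hat s=l^{-1}r\in F(X)$ be its relator. Let $N$ be the normal closure of all relators in $F(X)$, let $G=F(X)/N$, and let $\theta:F(X)\to G$ be the quotient map. The relation module is the abelianisation $N^{ab}$, with $G$ acting by $\theta(u)\cdot[n]=[unu^{-1}]$. The reduced Squier complex $\operatorname{Sq}^\rho(\mathcal P)$ is the $2$-complex with vertex set $F(X)$; with an edge $(p,l,r,q)$ from $plq$ to $prq$ for all $p,q\in F(X)$ and $(l,r)\in\mathcal R$; and with, for all $p,q,p',q'\in F(X)$ and $(l,r),(l',r')\in\mathcal R$, a $2$-cell whose boundary consists of the two edge paths $$(p,l,r,qp'l'q')\,(prqp',l',r',q')\quad\text{and}\quad (plqp',l',r',q')\,(p,l,r,qp'r'q').$$ The group $F(X)$ acts on homotopy classes of edge paths from the left and from the right by $u\rhd(p,l,r,q)=(up,l,r,q)$ and $(p,l,r,q)\lhd v=(p,l,r,qv)$.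 The fundamental group $\pi_1(\operatorname{Sq}^\rho(\mathcal P),1)$ is abelian, and it is a $G$-module by $\theta(u)\cdot[\alpha]=[u\rhd\alpha\lhd u^{-1}]$. The free crossed module $\partial:C(\mathcal P)\to F(X)$ on the relators is the group $C(\mathcal P)$ generated by the symbols $(s,a)$ with $s\in\mathcal R$, $a\in F(X)$, subject to the Peiffer relations $(s,a)^{-1}(t,b)(s,a)=(t,ba^{-1}\hat s a)$, with $\partial(s,a)=a^{-1}\hat s a$. The module of identities is $\pi(\mathcal P)=\ker\partial$, an abelian group on which $\theta(u)\in G$ acts by the restriction of the automorphism $(s,a)\mapsto(s,au^{-1})$ of $C(\mathcal P)$. (All modules are left modules.) Then there is a short exact sequence of $G$-modules $$0\longrightarrow \pi_1(\operatorname{Sq}^\rho(\mathcal P),1)\xrightarrow{\ \iota\ }\bigoplus_{s\in\mathcal R}\mathbb ZG\xrightarrow{\ p\ }N^{ab}\longrightarrow 0 .$$ Here $p$ sends the basis element $e_s$ to the class of $\hat s$, and $\iota$ sends the class of a closed edge path at $1$ to the sum, over its edges $(p,l,r,q)$, of $\pm\theta(q)^{-1}e_{(l,r)}$, with sign $-$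 when the edge is traversed backwards. Moreover $\pi_1(\operatorname{Sq}^\rho(\mathcal P),1)$ is isomorphic as a $G$-module to the module of identities $\pi(\mathcal P)$, by an isomorphism that carries $\iota$ to the restriction to $\pi(\mathcal P)$ of the homomorphism $C(\mathcal P)\to\bigoplus_{s\in\mathcal R}\mathbb ZG$, $(s,a)\mapsto\theta(a)^{-1}e_s$. -/

import Mathlib

open CategoryTheory

universe u v w

/-- Words in the alphabet `X ∪ X⁻¹`: the letter `(x, true)` is `x` and `(x, false)` is `x⁻¹`. -/
abbrev SignedWord (X : Type u) : Type u := List (X × Bool)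

/-- A group presentation `⟨X : 𝓡⟩`: a set `𝓡` of relations `(l, r)`, pairs of words, not necessarily
freely reduced, in the alphabet `X ∪ X⁻¹`. -/
structure GroupPresentation (X : Type u) where
  rels : Set (SignedWord X × SignedWord X)

namespace GroupPresentation

variable {X : Type u} (P : GroupPresentation X)

/-! ### The group, the relators and the normal subgroup `N` -/

variable {P} in
/-- The image in `F(X)` of the left hand side of a relation. -/
def lhs (i : P.rels) : FreeGroup X := FreeGroup.mk i.1.1

variable {P} in
/-- The image in `F(X)` of the right hand side of a relation. -/
def rhs (i : P.rels) : FreeGroup X := FreeGroup.mk i.1.2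

variable {P} in
/-- The relator `l⁻¹ r ∈ F(X)` of a relation `(l, r)`. -/
def relator (i : P.rels) : FreeGroup X := (lhs i)⁻¹ * rhs i

/-- The normal closure `N` of the relators in `F(X)`. -/
def N : Subgroup (FreeGroup X) := Subgroup.normalClosure (Set.range (relator (P := P)))

instance : P.N.Normal := by unfold N; infer_instance

/-- The group `G = F(X) / N` presented by `P`. -/
abbrev G : Type u := FreeGroup X ⧸ P.N

/-- The presentation map `θ : F(X) → G`. -/
def θ : FreeGroup X →* P.G := QuotientGroup.mk' P.N

/-- The integral group ring `ℤG`. -/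
abbrev ZG : Type u := MonoidAlgebra ℤ P.G

theorem relator_mem (i : P.rels) : relator i ∈ P.N :=
  Subgroup.subset_normalClosure ⟨i, rfl⟩

theorem θ_eq_one {n : FreeGroup X} (hn : n ∈ P.N) : P.θ n = 1 :=
  (QuotientGroup.eq_one_iff n).2 hn

theorem θ_lhs (i : P.rels) : P.θ (lhs i) = P.θ (rhs i) := by
  have h := P.θ_eq_one (P.relator_mem i)
  rw [relator, map_mul, map_inv] at h
  exact inv_mul_eq_one.1 h

/-! ### `ℤG`-modules from actions of `F(X)` that are trivial on `N` -/

/-- Automorphisms of a multiplicatively written abelian group as `ℤ`-linear endomorphisms. -/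
def mulAutToEnd (A : Type w) [CommGroup A] : MulAut A →* Module.End ℤ (Additive A) where
  toFun f := (MonoidHom.toAdditive f.toMonoidHom).toIntLinearMap
  map_one' := rfl
  map_mul' _ _ := rfl

/-- An action of `F(X)` on an abelian group `A` that is trivial on `N` makes `A`, written
additively, a representation of `G`. -/
def repOfAction {A : Type w} [CommGroup A] (φ : FreeGroup X →* MulAut A)
    (h : ∀ n ∈ P.N, φ n = 1) : Representation ℤ P.G (Additive A) :=
  (mulAutToEnd A).comp (QuotientGroup.lift P.N φ h)

/-- The `ℤG`-module with underlying abelian group `A`, written additively, on which `θ u ∈ G` acts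
as `φ u`. -/
noncomputable abbrev moduleOfAction {A : Type w} [CommGroup A] (φ : FreeGroup X →* MulAut A)
    (h : ∀ n ∈ P.N, φ n = 1) : Module P.ZG (Additive A) :=
  Module.compHom (Additive A) (P.repOfAction φ h).asAlgebraHom.toRingHom

/-! ### The relation module -/

/-- The action of `F(X)` on `N^{ab}` induced by conjugation, `n ↦ u n u⁻¹`. -/
def conjAb : FreeGroup X →* MulAut (Abelianization P.N) where
  toFun a := (MulAut.conjNormal a : MulAut P.N).abelianizationCongr
  map_one' := by
    ext x
    induction x using QuotientGroup.induction_on with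
    | H n => exact congrArg Abelianization.of (by ext; simp)
  map_mul' a b := by
    ext x
    induction x using QuotientGroup.induction_on with
    | H n => exact congrArg Abelianization.of (by ext; simp)

theorem conjAb_of (a : FreeGroup X) (n : P.N) :
    P.conjAb a (Abelianization.of n) = Abelianization.of (MulAut.conjNormal a n) := rfl

theorem conjAb_eq_one (a : FreeGroup X) (ha : a ∈ P.N) : P.conjAb a = 1 := by
  ext x
  induction x using QuotientGroup.induction_on with
  | H n =>
    change P.conjAb a (Abelianization.of n) = Abelianization.of n
    have h : MulAut.conjNormal a n = (⟨a, ha⟩ : P.N) * n * (⟨a, ha⟩ : P.N)⁻¹ := by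
      ext; simp
    rw [conjAb_of, h, map_mul, map_mul, map_inv, mul_comm, inv_mul_cancel_left]

/-- The relation module `N^{ab}`. -/
def RelationModule : Type u := Additive (Abelianization P.N)

instance : AddCommGroup P.RelationModule :=
  inferInstanceAs (AddCommGroup (Additive (Abelianization P.N)))

/-- `G` acts on `N^{ab}` by conjugation: `θ(u) • [n] = [u n u⁻¹]`. -/
noncomputable instance : Module P.ZG P.RelationModule :=
  P.moduleOfAction P.conjAb P.conjAb_eq_one

/-- The class in the relation module of an element of `N`. -/
def RelationModule.of (n : P.N) : P.RelationModule := Additive.ofMul (Abelianization.of n)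

/-! ### The free crossed module and the module of identities -/

/-- The Peiffer elements `(r,u)⁻¹ (s,v)⁻¹ (r,u) (s, v u⁻¹ ρ(r) u)` of the free group on
`𝓡 × F(X)`, where `ρ(r) ∈ F(X)` is the relator of `r`. -/
def peiffer : Set (FreeGroup (P.rels × FreeGroup X)) :=
  { x | ∃ (r s : P.rels) (a b : FreeGroup X),
    x = (FreeGroup.of (r, a))⁻¹ * (FreeGroup.of (s, b))⁻¹ * FreeGroup.of (r, a) *
      FreeGroup.of (s, b * a⁻¹ * relator r * a) }

/-- The group `C(P)` of the free crossed `F(X)`-module on the relators. -/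
abbrev C : Type u := PresentedGroup P.peiffer

variable {P} in
/-- The basic element `(r, a)` of `C(P)`. -/
def gen (r : P.rels) (a : FreeGroup X) : P.C := PresentedGroup.of (r, a)

theorem gen_peiffer (r s : P.rels) (a b : FreeGroup X) :
    (gen r a)⁻¹ * gen s b * gen r a = gen s (b * a⁻¹ * relator r * a) := by
  have h := PresentedGroup.one_of_mem (rels := P.peiffer) ⟨r, s, a, b, rfl⟩
  simp only [map_mul, map_inv] at h
  change (gen r a)⁻¹ * (gen s b)⁻¹ * gen r a * gen s (b * a⁻¹ * relator r * a) = 1 at h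
  have h2 := eq_inv_of_mul_eq_one_right h
  rw [h2]
  group

/-- The boundary map `∂ : C(P) → F(X)`, `(r, a) ↦ a⁻¹ ρ(r) a`. -/
def boundary : P.C →* FreeGroup X :=
  PresentedGroup.toGroup (f := fun x : P.rels × FreeGroup X => x.2⁻¹ * relator x.1 * x.2) (by
    rintro _ ⟨r, s, a, b, rfl⟩
    simp only [map_mul, map_inv, FreeGroup.lift_apply_of]
    group)

theorem boundary_gen (r : P.rels) (a : FreeGroup X) :
    P.boundary (gen r a) = a⁻¹ * relator r * a :=
  PresentedGroup.toGroup.of _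

/-- The endomorphism `(r, b) ↦ (r, b a⁻¹)` of `C(P)`. -/
def shift (a : FreeGroup X) : P.C →* P.C :=
  PresentedGroup.toGroup (f := fun x : P.rels × FreeGroup X => gen x.1 (x.2 * a⁻¹)) (by
    rintro _ ⟨r, s, c, b, rfl⟩
    simp only [map_mul, map_inv, FreeGroup.lift_apply_of]
    have h := P.gen_peiffer r s (c * a⁻¹) (b * a⁻¹)
    have e : b * a⁻¹ * (c * a⁻¹)⁻¹ * relator r * (c * a⁻¹) =
        b * c⁻¹ * relator r * c * a⁻¹ := by group
    rw [e] at h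
    rw [← h]
    group)

theorem shift_gen (a : FreeGroup X) (r : P.rels) (b : FreeGroup X) :
    P.shift a (gen r b) = gen r (b * a⁻¹) :=
  PresentedGroup.toGroup.of _

theorem shift_one : P.shift 1 = MonoidHom.id P.C := by
  ext x
  change P.shift 1 (gen x.1 x.2) = gen x.1 x.2
  rw [shift_gen, inv_one, mul_one]

theorem shift_mul (a b : FreeGroup X) : P.shift (a * b) = (P.shift a).comp (P.shift b) := by
  ext x
  change P.shift (a * b) (gen x.1 x.2) = P.shift a (P.shift b (gen x.1 x.2))
  rw [shift_gen, shift_gen, shift_gen, mul_inv_rev, mul_assoc]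

/-- The action of `F(X)` on `C(P)`, turned into a left action: in exponential notation for the
right action, `a` sends `c` to `c ^ (a⁻¹)`; thus `(r, b) ↦ (r, b a⁻¹)`. -/
def actC : FreeGroup X →* MulAut P.C where
  toFun a :=
    { P.shift a with
      invFun := P.shift a⁻¹
      left_inv := fun c => by
        change (P.shift a⁻¹).comp (P.shift a) c = c
        rw [← shift_mul, inv_mul_cancel, shift_one]; rfl
      right_inv := fun c => by
        change (P.shift a).comp (P.shift a⁻¹) c = c
        rw [← shift_mul, mul_inv_cancel, shift_one]; rfl }
  map_one' := by
    ext c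
    exact DFunLike.congr_fun P.shift_one c
  map_mul' a b := by
    ext c
    exact DFunLike.congr_fun (P.shift_mul a b) c

theorem actC_apply (a : FreeGroup X) (c : P.C) : P.actC a c = P.shift a c := rfl

theorem boundary_actC (a : FreeGroup X) (c : P.C) :
    P.boundary (P.actC a c) = a * P.boundary c * a⁻¹ := by
  have h : P.boundary.comp (P.shift a) = (MulAut.conj a).toMonoidHom.comp P.boundary := by
    ext x
    change P.boundary (P.shift a (gen x.1 x.2)) = a * P.boundary (gen x.1 x.2) * a⁻¹
    rw [shift_gen, boundary_gen, boundary_gen]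
    group
  exact DFunLike.congr_fun h c

theorem actC_boundary (d c : P.C) : P.actC (P.boundary d) c = d * c * d⁻¹ := by
  have key : ∀ d : P.C, P.shift (P.boundary d) = (MulAut.conj d).toMonoidHom := by
    intro d
    have hd : d ∈ Subgroup.closure (Set.range (PresentedGroup.of (rels := P.peiffer))) := by
      rw [PresentedGroup.closure_range_of]; trivial
    induction hd using Subgroup.closure_induction with
    | mem y hy =>
      obtain ⟨⟨r, a⟩, rfl⟩ := hy
      ext ⟨s, b⟩
      change P.shift (P.boundary (gen r a)) (gen s b) = gen r a * gen s b * (gen r a)⁻¹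
      have h := P.gen_peiffer r s a (b * (a⁻¹ * relator r * a)⁻¹)
      have e : b * (a⁻¹ * relator r * a)⁻¹ * a⁻¹ * relator r * a = b := by group
      rw [e] at h
      rw [shift_gen, boundary_gen, ← h]
      group
    | one => rw [map_one, shift_one, map_one]; rfl
    | mul y z _ _ hy hz => rw [map_mul, shift_mul, hy, hz, map_mul]; rfl
    | inv y _ hy =>
      have h1 : (P.shift (P.boundary y)).comp (P.shift (P.boundary y⁻¹)) =
          MonoidHom.id P.C := by
        rw [← shift_mul, ← map_mul, mul_inv_cancel, map_one, shift_one]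
      ext x
      have h2 := DFunLike.congr_fun h1 (PresentedGroup.of x)
      rw [hy] at h2
      change y * P.shift (P.boundary y⁻¹) (PresentedGroup.of x) * y⁻¹ = PresentedGroup.of x at h2
      change P.shift (P.boundary y⁻¹) (PresentedGroup.of x) =
        y⁻¹ * PresentedGroup.of x * y⁻¹⁻¹
      conv_rhs => rw [← h2]
      group
  exact DFunLike.congr_fun (key d) c

/-- The kernel of `∂ : C(P) → F(X)` is abelian, indeed central. -/
instance : CommGroup P.boundary.ker :=
  { (inferInstance : Group P.boundary.ker) with
    mul_comm := fun d c => by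
      have h := P.actC_boundary d c
      rw [(MonoidHom.mem_ker).1 d.2, map_one] at h
      ext
      change (d : P.C) * c = c * d
      exact (eq_mul_inv_iff_mul_eq.1 h).symm }

/-- The action of `F(X)` on the kernel of `∂`. -/
def actKer : FreeGroup X →* MulAut P.boundary.ker where
  toFun a :=
    { toFun := fun c => ⟨P.actC a c, by
        rw [MonoidHom.mem_ker, boundary_actC, (MonoidHom.mem_ker).1 c.2]; group⟩
      invFun := fun c => ⟨P.actC a⁻¹ c, by
        rw [MonoidHom.mem_ker, boundary_actC, (MonoidHom.mem_ker).1 c.2]; group⟩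
      left_inv := fun c => by ext; simp
      right_inv := fun c => by ext; simp
      map_mul' := fun c d => by ext; simp }
  map_one' := by ext; simp
  map_mul' a b := by ext; simp

theorem N_le_range_boundary : P.N ≤ P.boundary.range := by
  have hn : P.boundary.range.Normal := ⟨by
    rintro _ ⟨c, rfl⟩ a
    exact ⟨P.actC a c, P.boundary_actC a c⟩⟩
  refine Subgroup.normalClosure_le_normal ?_
  rintro _ ⟨r, rfl⟩
  exact ⟨gen r 1, by rw [boundary_gen]; group⟩

theorem actKer_eq_one (a : FreeGroup X) (ha : a ∈ P.N) : P.actKer a = 1 := by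
  obtain ⟨d, rfl⟩ := P.N_le_range_boundary ha
  ext c
  change P.actC (P.boundary d) c = c
  have h := P.actC_boundary c d
  rw [(MonoidHom.mem_ker).1 c.2, map_one] at h
  rw [actC_boundary]
  exact mul_inv_eq_iff_eq_mul.2 (eq_mul_inv_iff_mul_eq.1 h)

/-- The module of identities `π(P) = ker (∂ : C(P) → F(X))`. -/
def Identities : Type u := Additive P.boundary.ker

instance : AddCommGroup P.Identities := inferInstanceAs (AddCommGroup (Additive P.boundary.ker))

/-- `G` acts on `π(P)` by `θ(u) • c = c ^ (u⁻¹)`. -/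
noncomputable instance : Module P.ZG P.Identities := P.moduleOfAction P.actKer P.actKer_eq_one

/-- The underlying element of `C(P)` of an identity. -/
def Identities.val (x : P.Identities) : P.C := (Additive.toMul (α := P.boundary.ker) x).1

/-! ### The free module `⨁_{r ∈ 𝓡} ℤG` -/

/-- The free `ℤG`-module on the set of relations. -/
abbrev FreeMod : Type u := P.rels →₀ P.ZG

variable {P} in
/-- The basis element of `⨁_{r ∈ 𝓡} ℤG` with index `r`. -/
noncomputable def basisElt (r : P.rels) : P.FreeMod := Finsupp.single r 1

variable {P} in
/-- The element `θ(a)⁻¹ e_r` of `⨁_{r ∈ 𝓡} ℤG`. -/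
noncomputable def translate (r : P.rels) (a : FreeGroup X) : P.FreeMod :=
  (MonoidAlgebra.single (P.θ a)⁻¹ 1 : P.ZG) • basisElt r

/-- The homomorphism `C(P) → ⨁_{r ∈ 𝓡} ℤG`, `(r, a) ↦ θ(a)⁻¹ e_r` (the abelianisation of `C(P)`). -/
noncomputable def crossedToFree : P.C →* Multiplicative P.FreeMod :=
  PresentedGroup.toGroup
    (f := fun x : P.rels × FreeGroup X => Multiplicative.ofAdd (translate x.1 x.2)) (by
    rintro _ ⟨r, s, a, b, rfl⟩
    simp only [map_mul, map_inv, FreeGroup.lift_apply_of]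
    have h : translate s (b * a⁻¹ * relator r * a) = translate s b := by
      unfold translate
      rw [map_mul, map_mul, map_mul, P.θ_eq_one (P.relator_mem r), map_inv]
      simp
    rw [h, ← mul_inv, mul_assoc, inv_mul_cancel])

/-! ### The reduced Squier complex -/

/-- The vertices of the reduced Squier complex: the elements of `F(X)`. -/
@[ext]
structure Vertex (_ : GroupPresentation X) where
  elt : FreeGroup X

/-- An edge `(p, l, r, q)` of the reduced Squier complex: `p, q ∈ F(X)` and `(l, r) ∈ 𝓡`. -/
@[ext]
structure Edge where
  left : FreeGroup X
  rel : P.rels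
  right : FreeGroup X

/-- The initial vertex `p l q`. -/
def Edge.source {P : GroupPresentation X} (e : P.Edge) : FreeGroup X := e.left * lhs e.rel * e.right

/-- The terminal vertex `p r q`. -/
def Edge.target {P : GroupPresentation X} (e : P.Edge) : FreeGroup X := e.left * rhs e.rel * e.right

/-- The `1`-skeleton of the reduced Squier complex. -/
instance : Quiver P.Vertex where
  Hom a b := { e : P.Edge // e.source = a.elt ∧ e.target = b.elt }

/-- The free groupoid on the `1`-skeleton: its morphisms are edge paths up to insertion and deletion
of pairs of inverse edges. -/
abbrev PathGroupoid : Type u := Quiver.FreeGroupoid P.Vertex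

variable {P} in
/-- A single edge as a morphism of the free groupoid. -/
def edgeHom {a b : P.Vertex} (e : a ⟶ b) :
    (Quiver.FreeGroupoid.of P.Vertex).obj a ⟶ (Quiver.FreeGroupoid.of P.Vertex).obj b :=
  (Quiver.FreeGroupoid.of P.Vertex).map e

/-- The `2`-cells of the reduced Squier complex. For `p, q, p', q' ∈ F(X)` and relations
`i = (l, r)`, `j = (l', r')` there is a `2`-cell whose boundary consists of the two edge paths
`(p, l, r, q p' l' q') (p r q p', l', r', q')` and `(p l q p', l', r', q') (p, l, r, q p' r' q')`. -/
inductive Cell : HomRel P.PathGroupoid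
  | mk {a b c d : P.Vertex} (e₁ : a ⟶ b) (e₂ : b ⟶ d) (f₁ : a ⟶ c) (f₂ : c ⟶ d)
      (p q p' q' : FreeGroup X) (i j : P.rels)
      (he₁ : e₁.1 = ⟨p, i, q * p' * lhs j * q'⟩) (he₂ : e₂.1 = ⟨p * rhs i * q * p', j, q'⟩)
      (hf₁ : f₁.1 = ⟨p * lhs i * q * p', j, q'⟩) (hf₂ : f₂.1 = ⟨p, i, q * p' * rhs j * q'⟩) :
      Cell (edgeHom e₁ ≫ edgeHom e₂) (edgeHom f₁ ≫ edgeHom f₂)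

/-- The fundamental groupoid of the reduced Squier complex, with vertex set `F(X)`: edge paths up
to insertion and deletion of pairs of inverse edges, and up to exchanging the two sides of a
`2`-cell. -/
abbrev FundGpd : Type u := CategoryTheory.Quotient P.Cell

variable {P} in
/-- A vertex as an object of the fundamental groupoid. -/
def vtx (a : FreeGroup X) : P.FundGpd := ⟨⟨⟨a⟩⟩⟩

variable {P} in
/-- The homotopy class of a single edge. -/
def edgeClass {a b : P.Vertex} (e : a ⟶ b) : (vtx a.elt : P.FundGpd) ⟶ vtx b.elt :=
  (CategoryTheory.Quotient.functor P.Cell).map (edgeHom e)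

/-- Functors out of the fundamental groupoid. -/
def lift {D : Type v} [Groupoid.{w} D] (φ : P.Vertex ⥤q D)
    (h : ∀ {a b c d : P.Vertex} (e₁ : a ⟶ b) (e₂ : b ⟶ d) (f₁ : a ⟶ c) (f₂ : c ⟶ d)
      (p q p' q' : FreeGroup X) (i j : P.rels),
      e₁.1 = ⟨p, i, q * p' * lhs j * q'⟩ → e₂.1 = ⟨p * rhs i * q * p', j, q'⟩ →
      f₁.1 = ⟨p * lhs i * q * p', j, q'⟩ → f₂.1 = ⟨p, i, q * p' * rhs j * q'⟩ →
      φ.map e₁ ≫ φ.map e₂ = φ.map f₁ ≫ φ.map f₂) : P.FundGpd ⥤ D :=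
  CategoryTheory.Quotient.lift P.Cell (Quiver.FreeGroupoid.lift φ) (by
    rintro _ _ _ _ ⟨e₁, e₂, f₁, f₂, p, q, p', q', i, j, he₁, he₂, hf₁, hf₂⟩
    have key : ∀ {a b : P.Vertex} (e : a ⟶ b),
        (Quiver.FreeGroupoid.lift φ).map (edgeHom e) = φ.map e := by
      intro a b e
      exact Category.id_comp _
    rw [Functor.map_comp, Functor.map_comp, key, key, key, key]
    exact h e₁ e₂ f₁ f₂ p q p' q' i j he₁ he₂ hf₁ hf₂)

theorem lift_edgeClass {D : Type v} [Groupoid.{w} D] (φ : P.Vertex ⥤q D) (h) {a b : P.Vertex}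
    (e : a ⟶ b) : (P.lift φ h).map (edgeClass e) = φ.map e :=
  Category.id_comp _

variable {P} in
theorem cell_eq {a b c d : P.Vertex} (e₁ : a ⟶ b) (e₂ : b ⟶ d) (f₁ : a ⟶ c) (f₂ : c ⟶ d)
    (p q p' q' : FreeGroup X) (i j : P.rels)
    (he₁ : e₁.1 = ⟨p, i, q * p' * lhs j * q'⟩) (he₂ : e₂.1 = ⟨p * rhs i * q * p', j, q'⟩)
    (hf₁ : f₁.1 = ⟨p * lhs i * q * p', j, q'⟩) (hf₂ : f₂.1 = ⟨p, i, q * p' * rhs j * q'⟩) :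
    edgeClass e₁ ≫ edgeClass e₂ = edgeClass f₁ ≫ edgeClass f₂ :=
  CategoryTheory.Quotient.sound P.Cell (Cell.mk e₁ e₂ f₁ f₂ p q p' q' i j he₁ he₂ hf₁ hf₂)

variable {P} in
/-- A property of homotopy classes of paths that holds for trivial paths and is stable under
appending an edge or the inverse of an edge holds for all of them. -/
theorem path_induction {Q : ∀ {a b : FreeGroup X}, ((vtx a : P.FundGpd) ⟶ vtx b) → Prop}
    (h_id : ∀ a, Q (𝟙 (vtx a)))
    (h_edge : ∀ {a b c : FreeGroup X} (f : (vtx a : P.FundGpd) ⟶ vtx b)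
      (e : (⟨b⟩ : P.Vertex) ⟶ ⟨c⟩), Q f → Q (f ≫ edgeClass e))
    (h_inv : ∀ {a b c : FreeGroup X} (f : (vtx a : P.FundGpd) ⟶ vtx b)
      (e : (⟨c⟩ : P.Vertex) ⟶ ⟨b⟩), Q f → Q (f ≫ Groupoid.inv (edgeClass e)))
    {a b : FreeGroup X} (f : (vtx a : P.FundGpd) ⟶ vtx b) : Q f := by
  suffices h : ∀ {x y : P.Vertex} (g : Quiver.Path (V := Quiver.Symmetrify P.Vertex) x y),
      Q (a := x.elt) (b := y.elt) (Quot.mk _ (Quot.mk _ g)) by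
    obtain ⟨⟨g⟩⟩ := f
    exact h g
  clear f
  intro x y g
  induction g with
  | nil => exact h_id x.elt
  | cons g e ih =>
    obtain e | e := e
    · exact h_edge _ e ih
    · exact h_inv _ e ih

/-! ### Whiskering: the actions of `F(X)` on the fundamental groupoid -/

variable {P} in
/-- `u ▷ (p, l, r, q) = (u p, l, r, q)`. -/
def edgeL (u : FreeGroup X) {a b : FreeGroup X} (e : (⟨a⟩ : P.Vertex) ⟶ ⟨b⟩) :
    (⟨u * a⟩ : P.Vertex) ⟶ ⟨u * b⟩ :=
  ⟨⟨u * e.1.left, e.1.rel, e.1.right⟩, by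
    have h₁ : e.1.left * lhs e.1.rel * e.1.right = a := e.2.1
    have h₂ : e.1.left * rhs e.1.rel * e.1.right = b := e.2.2
    constructor <;> simp only [Edge.source, Edge.target, ← h₁, ← h₂, mul_assoc]⟩

variable {P} in
/-- `(p, l, r, q) ◁ v = (p, l, r, q v)`. -/
def edgeR (v : FreeGroup X) {a b : FreeGroup X} (e : (⟨a⟩ : P.Vertex) ⟶ ⟨b⟩) :
    (⟨a * v⟩ : P.Vertex) ⟶ ⟨b * v⟩ :=
  ⟨⟨e.1.left, e.1.rel, e.1.right * v⟩, by
    have h₁ : e.1.left * lhs e.1.rel * e.1.right = a := e.2.1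
    have h₂ : e.1.left * rhs e.1.rel * e.1.right = b := e.2.2
    constructor <;> simp only [Edge.source, Edge.target, ← h₁, ← h₂, mul_assoc]⟩

/-- The left action `α ↦ u ▷ α` on homotopy classes of paths. -/
def whiskerL (u : FreeGroup X) : P.FundGpd ⥤ P.FundGpd :=
  P.lift { obj := fun a => vtx (u * a.elt), map := fun e => edgeClass (edgeL u e) } (by
    intro a b c d e₁ e₂ f₁ f₂ p q p' q' i j he₁ he₂ hf₁ hf₂
    refine cell_eq _ _ _ _ (u * p) q p' q' i j ?_ ?_ ?_ ?_ <;>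
      simp only [edgeL, he₁, he₂, hf₁, hf₂, mul_assoc])

/-- The right action `α ↦ α ◁ v` on homotopy classes of paths. -/
def whiskerR (v : FreeGroup X) : P.FundGpd ⥤ P.FundGpd :=
  P.lift { obj := fun a => vtx (a.elt * v), map := fun e => edgeClass (edgeR v e) } (by
    intro a b c d e₁ e₂ f₁ f₂ p q p' q' i j he₁ he₂ hf₁ hf₂
    refine cell_eq _ _ _ _ p q p' (q' * v) i j ?_ ?_ ?_ ?_ <;>
      simp only [edgeR, he₁, he₂, hf₁, hf₂, mul_assoc])

variable {P} in
/-- `u ▷ α`. -/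
def wL (u : FreeGroup X) {a b : FreeGroup X} (f : (vtx a : P.FundGpd) ⟶ vtx b) :
    (vtx (u * a) : P.FundGpd) ⟶ vtx (u * b) := (P.whiskerL u).map f

variable {P} in
/-- `α ◁ v`. -/
def wR (v : FreeGroup X) {a b : FreeGroup X} (f : (vtx a : P.FundGpd) ⟶ vtx b) :
    (vtx (a * v) : P.FundGpd) ⟶ vtx (b * v) := (P.whiskerR v).map f

section whisker

variable {P}

theorem wL_id (u a : FreeGroup X) : wL u (𝟙 (vtx a : P.FundGpd)) = 𝟙 _ :=
  (P.whiskerL u).map_id _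

theorem wR_id (v a : FreeGroup X) : wR v (𝟙 (vtx a : P.FundGpd)) = 𝟙 _ :=
  (P.whiskerR v).map_id _

theorem wL_comp (u : FreeGroup X) {a b c : FreeGroup X} (f : (vtx a : P.FundGpd) ⟶ vtx b)
    (g : (vtx b : P.FundGpd) ⟶ vtx c) : wL u (f ≫ g) = wL u f ≫ wL u g :=
  (P.whiskerL u).map_comp _ _

theorem wR_comp (v : FreeGroup X) {a b c : FreeGroup X} (f : (vtx a : P.FundGpd) ⟶ vtx b)
    (g : (vtx b : P.FundGpd) ⟶ vtx c) : wR v (f ≫ g) = wR v f ≫ wR v g :=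
  (P.whiskerR v).map_comp _ _

theorem wL_inv (u : FreeGroup X) {a b : FreeGroup X} (f : (vtx a : P.FundGpd) ⟶ vtx b) :
    wL u (Groupoid.inv f) = Groupoid.inv (wL u f) := by
  rw [Groupoid.inv_eq_inv, Groupoid.inv_eq_inv]
  exact (P.whiskerL u).map_inv f

theorem wR_inv (v : FreeGroup X) {a b : FreeGroup X} (f : (vtx a : P.FundGpd) ⟶ vtx b) :
    wR v (Groupoid.inv f) = Groupoid.inv (wR v f) := by
  rw [Groupoid.inv_eq_inv, Groupoid.inv_eq_inv]
  exact (P.whiskerR v).map_inv f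

theorem wL_edge (u : FreeGroup X) {a b : FreeGroup X} (e : (⟨a⟩ : P.Vertex) ⟶ ⟨b⟩) :
    wL u (edgeClass e) = edgeClass (edgeL u e) := P.lift_edgeClass _ _ _

theorem wR_edge (v : FreeGroup X) {a b : FreeGroup X} (e : (⟨a⟩ : P.Vertex) ⟶ ⟨b⟩) :
    wR v (edgeClass e) = edgeClass (edgeR v e) := P.lift_edgeClass _ _ _

/-- The two composites `(α ◁ c) ∘ (b ▷ β)` and `(a ▷ β) ∘ (α ◁ d)` agree: the fundamental
groupoid is monoidal. -/
theorem interchange {a b c d : FreeGroup X} (f : (vtx a : P.FundGpd) ⟶ vtx b)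
    (g : (vtx c : P.FundGpd) ⟶ vtx d) : wR c f ≫ wL b g = wL a g ≫ wR d f := by
  refine path_induction (Q := fun {c d} g => wR c f ≫ wL b g = wL a g ≫ wR d f) ?_ ?_ ?_ g
  · intro c
    rw [wL_id, wL_id, Category.comp_id, Category.id_comp]
  all_goals
    have key : ∀ {c d : FreeGroup X} (e : (⟨c⟩ : P.Vertex) ⟶ ⟨d⟩),
        wR c f ≫ wL b (edgeClass e) = wL a (edgeClass e) ≫ wR d f := by
      intro c d e
      have base : ∀ {a b : FreeGroup X} (e' : (⟨a⟩ : P.Vertex) ⟶ ⟨b⟩),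
          wR c (edgeClass e') ≫ wL b (edgeClass e) =
            wL a (edgeClass e) ≫ wR d (edgeClass e') := by
        intro a b e'
        have h₁ : e'.1.left * lhs e'.1.rel * e'.1.right = a := e'.2.1
        have h₂ : e'.1.left * rhs e'.1.rel * e'.1.right = b := e'.2.2
        have h₃ : e.1.left * lhs e.1.rel * e.1.right = c := e.2.1
        have h₄ : e.1.left * rhs e.1.rel * e.1.right = d := e.2.2
        rw [wR_edge, wR_edge, wL_edge, wL_edge]
        refine cell_eq _ _ _ _ e'.1.left e'.1.right e.1.left e.1.right e'.1.rel e.1.rel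
          ?_ ?_ ?_ ?_ <;>
          simp only [edgeL, edgeR, ← h₁, ← h₂, ← h₃, ← h₄, mul_assoc]
      refine path_induction (Q := fun {a b} f =>
        wR c f ≫ wL b (edgeClass e) = wL a (edgeClass e) ≫ wR d f) ?_ ?_ ?_ f
      · intro a
        rw [wR_id, wR_id, Category.comp_id, Category.id_comp]
      · intro a b b' f e' hf
        rw [wR_comp, wR_comp, Category.assoc, base, ← Category.assoc, hf, Category.assoc]
      · intro a b b' f e' hf
        have hb : wR c (Groupoid.inv (edgeClass e')) ≫ wL b' (edgeClass e) =
            wL b (edgeClass e) ≫ wR d (Groupoid.inv (edgeClass e')) := by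
          rw [wR_inv, wR_inv, Groupoid.inv_eq_inv, Groupoid.inv_eq_inv, IsIso.inv_comp_eq,
            ← Category.assoc, IsIso.eq_comp_inv]
          exact (base e').symm
        rw [wR_comp, wR_comp, Category.assoc, hb, ← Category.assoc, hf, Category.assoc]
  · intro c d d' g e hg
    rw [wL_comp, wL_comp, ← Category.assoc, hg, Category.assoc, key, Category.assoc]
  · intro c d d' g e hg
    have hb : wR d f ≫ wL b (Groupoid.inv (edgeClass e)) =
        wL a (Groupoid.inv (edgeClass e)) ≫ wR d' f := by
      rw [wL_inv, wL_inv, Groupoid.inv_eq_inv, Groupoid.inv_eq_inv, IsIso.eq_inv_comp,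
        ← Category.assoc, IsIso.comp_inv_eq]
      exact (key e).symm
    rw [wL_comp, wL_comp, ← Category.assoc, hg, Category.assoc, hb, Category.assoc]

theorem edgeClass_heq {a b a' b' : P.Vertex} (ha : a = a') (hb : b = b') (e : a ⟶ b)
    (e' : a' ⟶ b') (h : e.1 = e'.1) : HEq (edgeClass e) (edgeClass e') := by
  subst ha hb
  rw [Subtype.ext h]

theorem functor_ext {F F' : P.FundGpd ⥤ P.FundGpd} (h₀ : ∀ a, F.obj (vtx a) = F'.obj (vtx a))
    (h₁ : ∀ {a b : FreeGroup X} (e : (⟨a⟩ : P.Vertex) ⟶ ⟨b⟩),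
      HEq (F.map (edgeClass e)) (F'.map (edgeClass e))) : F = F' := by
  refine CategoryTheory.Functor.ext (fun a => h₀ a.as.as.elt) fun a b f => ?_
  refine path_induction (P := P) (a := a.as.as.elt) (b := b.as.as.elt) (Q := fun {a b} f =>
    F.map f = eqToHom (h₀ a) ≫ F'.map f ≫ eqToHom (h₀ b).symm) ?_ ?_ ?_ f
  · intro a
    simp
  · intro a b c f e hf
    have he := h₁ e
    rw [← conj_eqToHom_iff_heq _ _ (h₀ b) (h₀ c)] at he
    rw [F.map_comp, hf]
    erw [he]
    simp
  · intro a b c f e hf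
    have he := h₁ e
    rw [← conj_eqToHom_iff_heq _ _ (h₀ c) (h₀ b)] at he
    rw [Groupoid.inv_eq_inv, F.map_comp, hf, F.map_inv, IsIso.comp_inv_eq]
    erw [he]
    simp

theorem whiskerL_one : P.whiskerL 1 = 𝟭 _ := by
  refine functor_ext (fun a => congrArg vtx (one_mul a)) fun {a b} e => ?_
  refine (heq_of_eq (wL_edge 1 e)).trans (edgeClass_heq ?_ ?_ _ _ ?_) <;>
    simp [edgeL]

theorem whiskerR_one : P.whiskerR 1 = 𝟭 _ := by
  refine functor_ext (fun a => congrArg vtx (mul_one a)) fun {a b} e => ?_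
  refine (heq_of_eq (wR_edge 1 e)).trans (edgeClass_heq ?_ ?_ _ _ ?_) <;>
    simp [edgeR]

theorem whiskerL_mul (u v : FreeGroup X) : P.whiskerL v ⋙ P.whiskerL u = P.whiskerL (u * v) := by
  refine functor_ext (fun a => congrArg vtx (mul_assoc u v a).symm) fun {a b} e => ?_
  refine HEq.trans (heq_of_eq ((congrArg (wL u) (wL_edge v e)).trans (wL_edge u _)))
    (HEq.trans (edgeClass_heq ?_ ?_ _ _ ?_) (heq_of_eq (wL_edge (u * v) e)).symm) <;>
    simp [edgeL, mul_assoc]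

theorem whiskerR_mul (u v : FreeGroup X) : P.whiskerR u ⋙ P.whiskerR v = P.whiskerR (u * v) := by
  refine functor_ext (fun a => congrArg vtx (mul_assoc a u v)) fun {a b} e => ?_
  refine HEq.trans (heq_of_eq ((congrArg (wR v) (wR_edge u e)).trans (wR_edge v _)))
    (HEq.trans (edgeClass_heq ?_ ?_ _ _ ?_) (heq_of_eq (wR_edge (u * v) e)).symm) <;>
    simp [edgeR, mul_assoc]

theorem whiskerLR (u v : FreeGroup X) :
    P.whiskerL u ⋙ P.whiskerR v = P.whiskerR v ⋙ P.whiskerL u := by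
  refine functor_ext (fun a => congrArg vtx (mul_assoc u a v)) fun {a b} e => ?_
  refine HEq.trans (heq_of_eq ((congrArg (wR v) (wL_edge u e)).trans (wR_edge v _)))
    (HEq.trans (edgeClass_heq ?_ ?_ _ _ ?_)
      (heq_of_eq ((congrArg (wL u) (wR_edge v e)).trans (wL_edge u _))).symm) <;>
    simp [edgeL, edgeR, mul_assoc]

end whisker

/-! ### The fundamental group as a `ℤG`-module -/

/-- The fundamental group of the reduced Squier complex at the vertex `1`: homotopy classes of
closed edge paths at `1`. -/
abbrev LoopGroup : Type u := (vtx 1 : P.FundGpd) ⟶ vtx 1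

section loops

variable {P}

/-- `α ↦ u ▷ α ◁ u⁻¹` on closed paths at `1` (note that `u 1 u⁻¹ = 1`). -/
def conjLoop (u : FreeGroup X) (f : P.LoopGroup) : P.LoopGroup :=
  eqToHom (congrArg vtx (by group)) ≫ wR u⁻¹ (wL u f) ≫ eqToHom (congrArg vtx (by group))

theorem conjLoop_eq_iff (u : FreeGroup X) (f g : P.LoopGroup) :
    conjLoop u f = g ↔ HEq ((P.whiskerL u ⋙ P.whiskerR u⁻¹).map f) g := by
  have h : (vtx (u * 1 * u⁻¹) : P.FundGpd) = vtx 1 := congrArg vtx (by group)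
  refine Iff.trans ?_ (conj_eqToHom_iff_heq (wR u⁻¹ (wL u f)) g h h)
  change eqToHom _ ≫ wR u⁻¹ (wL u f) ≫ eqToHom _ = g ↔ wR u⁻¹ (wL u f) = _
  constructor
  · rintro rfl
    simp
  · intro e
    rw [e]
    simp

theorem conjLoop_heq (u : FreeGroup X) (f : P.LoopGroup) :
    HEq ((P.whiskerL u ⋙ P.whiskerR u⁻¹).map f) (conjLoop u f) := (conjLoop_eq_iff u f _).1 rfl

theorem map_heq (F : P.FundGpd ⥤ P.FundGpd) {a b a' b' : P.FundGpd} (ha : a = a') (hb : b = b')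
    (f : a ⟶ b) (f' : a' ⟶ b') (h : HEq f f') : HEq (F.map f) (F.map f') := by
  subst ha hb
  rw [eq_of_heq h]

theorem functor_heq {F F' : P.FundGpd ⥤ P.FundGpd} (h : F = F') {a b : P.FundGpd} (f : a ⟶ b) :
    HEq (F.map f) (F'.map f) := by
  rw [h]

theorem conjLoop_one (f : P.LoopGroup) : conjLoop 1 f = f := by
  rw [conjLoop_eq_iff]
  have h : P.whiskerL 1 ⋙ P.whiskerR 1⁻¹ = 𝟭 _ := by
    rw [inv_one, whiskerL_one, whiskerR_one]; rfl
  exact functor_heq h f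

theorem conjLoop_mul (u v : FreeGroup X) (f : P.LoopGroup) :
    conjLoop (u * v) f = conjLoop u (conjLoop v f) := by
  rw [conjLoop_eq_iff]
  have h : P.whiskerL (u * v) ⋙ P.whiskerR (u * v)⁻¹ =
      (P.whiskerL v ⋙ P.whiskerR v⁻¹) ⋙ P.whiskerL u ⋙ P.whiskerR u⁻¹ := by
    rw [mul_inv_rev, ← whiskerR_mul, ← whiskerL_mul, Functor.assoc, Functor.assoc,
      ← Functor.assoc (P.whiskerR v⁻¹), ← whiskerLR, Functor.assoc]
  refine (functor_heq h f).trans (HEq.trans ?_ (conjLoop_heq u _))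
  have e : (vtx (v * 1 * v⁻¹) : P.FundGpd) = vtx 1 := congrArg vtx (by group)
  exact map_heq (P.whiskerL u ⋙ P.whiskerR u⁻¹) e e _ _ (conjLoop_heq v f)

theorem conjLoop_map_mul (u : FreeGroup X) (f g : P.LoopGroup) :
    conjLoop u (f * g) = conjLoop u f * conjLoop u g := by
  change eqToHom _ ≫ wR u⁻¹ (wL u (f ≫ g)) ≫ eqToHom _ =
    (eqToHom _ ≫ wR u⁻¹ (wL u f) ≫ eqToHom _) ≫ eqToHom _ ≫ wR u⁻¹ (wL u g) ≫ eqToHom _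
  rw [wL_comp, wR_comp]
  simp

theorem wL_one {a b : FreeGroup X} (f : (vtx a : P.FundGpd) ⟶ vtx b) : HEq (wL 1 f) f :=
  functor_heq whiskerL_one f

theorem wR_one {a b : FreeGroup X} (f : (vtx a : P.FundGpd) ⟶ vtx b) : HEq (wR 1 f) f :=
  functor_heq whiskerR_one f

theorem comp_heq {a b c a' b' c' : P.FundGpd} (ha : a = a') (hb : b = b') (hc : c = c')
    {f : a ⟶ b} {g : b ⟶ c} {f' : a' ⟶ b'} {g' : b' ⟶ c'} (hf : HEq f f') (hg : HEq g g') :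
    HEq (f ≫ g) (f' ≫ g') := by
  subst ha hb hc
  rw [eq_of_heq hf, eq_of_heq hg]

theorem heq_cancel {a b b' c c' : P.FundGpd} (hb : b = b') (hc : c = c') (β : a ⟶ b) (β' : a ⟶ b')
    {f : b ⟶ c} {f' : b' ⟶ c'} (h : HEq β β') (h' : HEq (β ≫ f) (β' ≫ f')) : HEq f f' := by
  subst hb hc
  obtain rfl := eq_of_heq h
  exact heq_of_eq ((cancel_epi β).1 (eq_of_heq h'))

theorem loop_mul_comm (f g : P.LoopGroup) : f * g = g * f := by
  have e : (vtx (1 * 1) : P.FundGpd) = vtx 1 := congrArg vtx (mul_one 1)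
  have h := interchange (P := P) f g
  refine eq_of_heq (HEq.trans ?_ ((heq_of_eq h).trans ?_))
  · exact (comp_heq e e e (wR_one f) (wL_one g)).symm
  · exact comp_heq e e e (wL_one g) (wR_one f)

/-- Every element of `N` lies in the connected component of `1`. -/
theorem nonempty_path {n : FreeGroup X} (hn : n ∈ P.N) :
    Nonempty ((vtx 1 : P.FundGpd) ⟶ vtx n) := by
  have cast_path : ∀ {a b a' b' : FreeGroup X}, a = a' → b = b' →
      ((vtx a : P.FundGpd) ⟶ vtx b) → ((vtx a' : P.FundGpd) ⟶ vtx b') := by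
    rintro a b a' b' rfl rfl f
    exact f
  let S : Subgroup (FreeGroup X) :=
    { carrier := { n | Nonempty ((vtx 1 : P.FundGpd) ⟶ vtx n) }
      one_mem' := ⟨𝟙 _⟩
      mul_mem' := by
        rintro a b ⟨f⟩ ⟨g⟩
        exact ⟨g ≫ cast_path (one_mul b) rfl (wR b f)⟩
      inv_mem' := by
        rintro a ⟨f⟩
        exact ⟨Groupoid.inv (cast_path (one_mul _) (mul_inv_cancel a) (wR a⁻¹ f))⟩ }
  have hS : S.Normal := ⟨by
    rintro a ⟨f⟩ u
    exact ⟨cast_path (by group) rfl (wR u⁻¹ (wL u f))⟩⟩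
  have h : P.N ≤ S := by
    refine Subgroup.normalClosure_le_normal ?_
    rintro _ ⟨i, rfl⟩
    refine ⟨edgeClass (P := P) (a := ⟨1⟩) (b := ⟨relator i⟩) ⟨⟨(lhs i)⁻¹, i, 1⟩, ?_, ?_⟩⟩
    · simp [Edge.source]
    · simp [Edge.target, relator]
  exact h hn

theorem conjLoop_of_mem {n : FreeGroup X} (hn : n ∈ P.N) (f : P.LoopGroup) : conjLoop n f = f := by
  obtain ⟨β⟩ := nonempty_path hn
  have e₁ : (vtx (1 * 1) : P.FundGpd) = vtx 1 := congrArg vtx (mul_one 1)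
  have e₂ : (vtx (1 * n) : P.FundGpd) = vtx n := congrArg vtx (one_mul n)
  have e₃ : (vtx (n * 1) : P.FundGpd) = vtx n := congrArg vtx (mul_one n)
  have h₁ := interchange (P := P) f β
  have h₂ := interchange (P := P) β f
  have key : HEq (wL n f) (wR n f) := by
    refine heq_cancel (e₃.trans e₂.symm) (e₃.trans e₂.symm) (wR 1 β) (wL 1 β)
      ((wR_one β).trans (wL_one β).symm) ?_
    rw [h₂, ← h₁]
    exact comp_heq rfl rfl (e₃.trans e₂.symm)
      ((wL_one f).trans (wR_one f).symm) ((wR_one β).trans (wL_one β).symm)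
  rw [conjLoop_eq_iff]
  have h : P.whiskerR n ⋙ P.whiskerR n⁻¹ = 𝟭 _ := by
    rw [whiskerR_mul, mul_inv_cancel, whiskerR_one]
  exact (map_heq (P.whiskerR n⁻¹) (e₃.trans e₂.symm) (e₃.trans e₂.symm) _ _ key).trans
    (functor_heq h f)

end loops

/-- The fundamental group at `1` is abelian. -/
instance : CommGroup P.LoopGroup :=
  { (inferInstance : Group P.LoopGroup) with mul_comm := loop_mul_comm }

/-- The action `α ↦ u ▷ α ◁ u⁻¹` of `F(X)` on the fundamental group at `1`. -/
def actLoop : FreeGroup X →* MulAut P.LoopGroup where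
  toFun u :=
    { toFun := conjLoop u
      invFun := conjLoop u⁻¹
      left_inv := fun f => by rw [← conjLoop_mul, inv_mul_cancel, conjLoop_one]
      right_inv := fun f => by rw [← conjLoop_mul, mul_inv_cancel, conjLoop_one]
      map_mul' := conjLoop_map_mul u }
  map_one' := by
    ext f
    exact conjLoop_one f
  map_mul' u v := by
    ext f
    exact conjLoop_mul u v f

theorem actLoop_eq_one (n : FreeGroup X) (hn : n ∈ P.N) : P.actLoop n = 1 := by
  ext f
  exact conjLoop_of_mem hn f

/-- The fundamental group `π₁(Sq^ρ(P), 1)`, written additively. -/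
def Pi1 : Type u := Additive P.LoopGroup

instance : AddCommGroup P.Pi1 := inferInstanceAs (AddCommGroup (Additive P.LoopGroup))

/-- `G` acts on `π₁(Sq^ρ(P), 1)` by `θ(u) • [α] = [u ▷ α ◁ u⁻¹]`. -/
noncomputable instance : Module P.ZG P.Pi1 := P.moduleOfAction P.actLoop P.actLoop_eq_one

/-- The functor from the fundamental groupoid to the additive group `⨁_{r ∈ 𝓡} ℤG` (a groupoid with
one object) that sends an edge `(p, l, r, q)` to `θ(q)⁻¹ e_{(l, r)}`. -/
noncomputable def weight : P.FundGpd ⥤ SingleObj (Multiplicative P.FreeMod) :=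
  P.lift
    { obj := fun _ => SingleObj.star _
      map := fun e => Multiplicative.ofAdd (translate e.1.rel e.1.right) } (by
    intro a b c d e₁ e₂ f₁ f₂ p q p' q' i j he₁ he₂ hf₁ hf₂
    have h : translate i (q * p' * lhs j * q') = translate i (q * p' * rhs j * q') := by
      unfold translate
      simp only [map_mul, θ_lhs]
    simp only [he₁, he₂, hf₁, hf₂, h]
    exact mul_comm (G := Multiplicative P.FreeMod) _ _)

/-- The value on a closed path at `1`: the sum, over the edges `(p, l, r, q)` of the path, of
`± θ(q)⁻¹ e_{(l, r)}`, with sign `-` for an edge traversed backwards. -/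
noncomputable def Pi1.weight {P : GroupPresentation X} (x : P.Pi1) : P.FreeMod :=
  Multiplicative.toAdd (α := P.FreeMod)
    (P.weight.map (X := vtx 1) (Y := vtx 1) (Additive.toMul (α := P.LoopGroup) x))

end GroupPresentation

namespace GroupPresentation

variable {X : Type u} {P : GroupPresentation X}

/-! ### Paths and the free crossed module -/

/-! Label each edge `(p, l, r, q)` by the generator `((l, r), q)` of `C(P)`. The starting vertex and
the label determine the edge, since `p = a q⁻¹ l⁻¹` when it starts at `a`, and the edge multiplies
its starting vertex on the right by `q⁻¹ l⁻¹ r q`, the boundary of the label. The two sides of a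
2-cell give exactly a Peiffer relation. So reading labels is a well-defined map `pathVal` on
homotopy classes of paths, and conversely `C(P)` acts on the classes of paths from `1` by adding and
removing edges (`pathAction`). The two constructions are mutually inverse: a path from `1` is
recovered from its value, every element of `C(P)` is a value, and the end point is the boundary of
the value. Closed paths at `1` therefore correspond to `ker ∂` (`loopHom_bijective`), equivariantly
by `pathVal_conjLoop`.

It remains to embed `ker ∂` in the free module. The map `crossedToFree` is the abelianisation of
`C(P)`. Since `N` is free, as a subgroup of a free group, `∂ : C(P) → N` has a section, and since
`ker ∂` is central, `C(P)` retracts onto `ker ∂` by a homomorphism (`exists_retraction`). The target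
of the retraction is abelian, so `ker ∂` meets the commutator subgroup trivially and injects into
the free module (`eq_one_of_boundary_of_crossedToFree`). Exactness in the middle holds because `∂`
maps `[C(P), C(P)]` onto `[N, N]`, so an element over zero in `N^{ab}` can be corrected by
commutators to an identity (`exists_identity_of_relationMap_eq_zero`). -/

variable (P) in
/-- The functor from the fundamental groupoid to the group `C(P)` (with composition of paths
corresponding to multiplication from left to right) that sends an edge `(p, l, r, q)` to
`((l, r), q)`. -/
def pathFunctor : P.FundGpd ⥤ SingleObj P.Cᵐᵒᵖ :=
  P.lift
    { obj := fun _ => SingleObj.star _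
      map := fun e => MulOpposite.op (gen e.1.rel e.1.right) } (by
    intro a b c d e₁ e₂ f₁ f₂ p q p' q' i j he₁ he₂ hf₁ hf₂
    -- Conjugating `(i, q p' l' q')` by `(j, q')` replaces `l'` by `r'` in the right factor, which
    -- is the passage from one side of the cell to the other.
    have h := P.gen_peiffer j i q' (q * p' * lhs j * q')
    have e : q * p' * lhs j * q' * q'⁻¹ * relator j * q' = q * p' * rhs j * q' := by
      simp only [relator]
      group
    rw [e, mul_assoc, inv_mul_eq_iff_eq_mul] at h
    simp only [he₁, he₂, hf₁, hf₂]
    exact congrArg MulOpposite.op h)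

/-- The element of `C(P)` read off a path. -/
def pathVal {a b : FreeGroup X} (f : (vtx a : P.FundGpd) ⟶ vtx b) : P.C :=
  MulOpposite.unop (α := P.C) (P.pathFunctor.map f)

theorem pathVal_id (a : FreeGroup X) : pathVal (𝟙 (vtx a : P.FundGpd)) = 1 :=
  congrArg (MulOpposite.unop (α := P.C)) (P.pathFunctor.map_id (vtx a))

theorem pathVal_comp {a b c : FreeGroup X} (f : (vtx a : P.FundGpd) ⟶ vtx b)
    (g : (vtx b : P.FundGpd) ⟶ vtx c) : pathVal (f ≫ g) = pathVal f * pathVal g :=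
  congrArg (MulOpposite.unop (α := P.C)) (P.pathFunctor.map_comp f g)

theorem pathVal_edge {a b : FreeGroup X} (e : (⟨a⟩ : P.Vertex) ⟶ ⟨b⟩) :
    pathVal (edgeClass e) = gen e.1.rel e.1.right :=
  congrArg (MulOpposite.unop (α := P.C)) (P.lift_edgeClass _ _ e)

theorem pathVal_inv {a b : FreeGroup X} (f : (vtx a : P.FundGpd) ⟶ vtx b) :
    pathVal (Groupoid.inv f) = (pathVal f)⁻¹ := by
  rw [eq_inv_iff_mul_eq_one, ← pathVal_comp, Groupoid.inv_comp, pathVal_id]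

theorem pathVal_eqToHom {a b : FreeGroup X} (h : a = b) (h' : (vtx a : P.FundGpd) = vtx b) :
    pathVal (eqToHom h') = 1 := by
  subst h
  exact pathVal_id a

/-- For one edge, `(p l q)⁻¹ (p r q) = q⁻¹ (l⁻¹ r) q`; along a path these quotients telescope. -/
theorem boundary_pathVal {a b : FreeGroup X} (f : (vtx a : P.FundGpd) ⟶ vtx b) :
    P.boundary (pathVal f) = a⁻¹ * b := by
  have key : ∀ {b c : FreeGroup X} (e : (⟨b⟩ : P.Vertex) ⟶ ⟨c⟩),
      P.boundary (pathVal (edgeClass e)) = b⁻¹ * c := by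
    intro b c e
    rw [pathVal_edge, boundary_gen]
    obtain ⟨⟨p, i, q⟩, (rfl : _ = b), (rfl : _ = c)⟩ := e
    simp only [Edge.source, Edge.target, relator]
    group
  refine path_induction (Q := fun {a b} f => P.boundary (pathVal f) = a⁻¹ * b) ?_ ?_ ?_ f
  · intro a
    rw [pathVal_id, map_one, inv_mul_cancel]
  · intro a b c f e hf
    rw [pathVal_comp, map_mul, hf, key]
    group
  · intro a b c f e hf
    rw [pathVal_comp, pathVal_inv, map_mul, map_inv, hf, key]
    group

/-- The label of an edge forgets its left factor, the only thing that left whiskering changes. -/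
theorem pathVal_wL (u : FreeGroup X) {a b : FreeGroup X} (f : (vtx a : P.FundGpd) ⟶ vtx b) :
    pathVal (wL u f) = pathVal f := by
  refine path_induction (Q := fun {a b} f => pathVal (wL u f) = pathVal f) ?_ ?_ ?_ f
  · intro a
    rw [wL_id, pathVal_id, pathVal_id]
  · intro a b c f e hf
    rw [wL_comp, pathVal_comp, pathVal_comp, hf, wL_edge, pathVal_edge, pathVal_edge]
    rfl
  · intro a b c f e hf
    rw [wL_comp, pathVal_comp, pathVal_comp, hf, wL_inv, wL_edge, pathVal_inv, pathVal_inv,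
      pathVal_edge, pathVal_edge]
    rfl

theorem pathVal_wR (v : FreeGroup X) {a b : FreeGroup X} (f : (vtx a : P.FundGpd) ⟶ vtx b) :
    pathVal (wR v f) = P.shift v⁻¹ (pathVal f) := by
  have key : ∀ {b c : FreeGroup X} (e : (⟨b⟩ : P.Vertex) ⟶ ⟨c⟩),
      pathVal (edgeClass (edgeR v e)) = P.shift v⁻¹ (pathVal (edgeClass e)) := by
    intro b c e
    rw [pathVal_edge, pathVal_edge, shift_gen, inv_inv]
    rfl
  refine path_induction (Q := fun {a b} f => pathVal (wR v f) = P.shift v⁻¹ (pathVal f))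
    ?_ ?_ ?_ f
  · intro a
    rw [wR_id, pathVal_id, pathVal_id, map_one]
  · intro a b c f e hf
    rw [wR_comp, pathVal_comp, pathVal_comp, hf, wR_edge, key, map_mul]
  · intro a b c f e hf
    rw [wR_comp, pathVal_comp, pathVal_comp, hf, wR_inv, wR_edge, pathVal_inv, pathVal_inv,
      key, map_mul, map_inv]

/-- Only the right whiskering by `u⁻¹` is visible in the labels, and it acts as `shift u`. This
gives the equivariance of the isomorphism with the module of identities. -/
theorem pathVal_conjLoop (u : FreeGroup X) (f : P.LoopGroup) :
    pathVal (conjLoop u f) = P.actC u (pathVal f) := by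
  have e : u * 1 * u⁻¹ = 1 := by group
  change pathVal (eqToHom _ ≫ wR u⁻¹ (wL u f) ≫ eqToHom _) = P.shift u (pathVal f)
  rw [pathVal_comp, pathVal_comp, pathVal_wR, pathVal_wL, inv_inv, pathVal_eqToHom e.symm,
    pathVal_eqToHom e, one_mul, mul_one]

/-! ### The action of `C(P)` on paths that start at `1` -/

variable (P) in
/-- The homotopy classes of paths in the reduced Squier complex that start at `1`. -/
abbrev PathsFromOne : Type u := Σ b : FreeGroup X, ((vtx 1 : P.FundGpd) ⟶ vtx b)

theorem PathsFromOne.ext {b b' : FreeGroup X} (h : b = b') {f : (vtx 1 : P.FundGpd) ⟶ vtx b}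
    {f' : (vtx 1 : P.FundGpd) ⟶ vtx b'} (hf : HEq f f') :
    (⟨b, f⟩ : P.PathsFromOne) = ⟨b', f'⟩ := by
  subst h
  rw [eq_of_heq hf]

/-- The edge with relation `i` and right factor `q` that starts at the vertex `a`. -/
def edgeFrom (i : P.rels) (q a : FreeGroup X) :
    (⟨a⟩ : P.Vertex) ⟶ ⟨a * (q⁻¹ * relator i * q)⟩ :=
  ⟨⟨a * q⁻¹ * (lhs i)⁻¹, i, q⟩, by
    constructor <;> simp only [Edge.source, Edge.target, relator] <;> group⟩

/-- The edge with relation `i` and right factor `q` that ends at the vertex `a`. -/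
def edgeTo (i : P.rels) (q a : FreeGroup X) :
    (⟨a * (q⁻¹ * relator i * q)⁻¹⟩ : P.Vertex) ⟶ ⟨a⟩ :=
  ⟨⟨a * q⁻¹ * (rhs i)⁻¹, i, q⟩, by
    constructor <;> simp only [Edge.source, Edge.target, relator] <;> group⟩

/-- With `edge_target`, this shows that an edge is determined by its starting vertex, its relation
and its right factor. -/
theorem edge_left {a b : FreeGroup X} (e : (⟨a⟩ : P.Vertex) ⟶ ⟨b⟩) :
    e.1.left = a * e.1.right⁻¹ * (lhs e.1.rel)⁻¹ := by
  obtain ⟨⟨p, i, q⟩, (rfl : _ = a), (rfl : _ = b)⟩ := e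
  simp only [Edge.source]
  group

theorem edge_target {a b : FreeGroup X} (e : (⟨a⟩ : P.Vertex) ⟶ ⟨b⟩) :
    b = a * (e.1.right⁻¹ * relator e.1.rel * e.1.right) := by
  obtain ⟨⟨p, i, q⟩, (rfl : _ = a), (rfl : _ = b)⟩ := e
  simp only [Edge.source, Edge.target, relator]
  group

/-- Appending the edge with relation `i` and right factor `q`. -/
def appendEdge (i : P.rels) (q : FreeGroup X) (x : P.PathsFromOne) : P.PathsFromOne :=
  ⟨_, x.2 ≫ edgeClass (edgeFrom i q x.1)⟩

/-- Appending the inverse of the edge with relation `i` and right factor `q`. -/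
def appendInvEdge (i : P.rels) (q : FreeGroup X) (x : P.PathsFromOne) : P.PathsFromOne :=
  ⟨_, x.2 ≫ Groupoid.inv (edgeClass (edgeTo i q x.1))⟩

/-- By uniqueness `e` is the edge `edgeFrom i q a`. The end points agree only propositionally, so
the comparison is made in the sigma type of paths. -/
theorem appendEdge_eq {a b : FreeGroup X} (f : (vtx 1 : P.FundGpd) ⟶ vtx a)
    (e : (⟨a⟩ : P.Vertex) ⟶ ⟨b⟩) (i : P.rels) (q : FreeGroup X) (hi : e.1.rel = i)
    (hq : e.1.right = q) : appendEdge i q ⟨a, f⟩ = ⟨b, f ≫ edgeClass e⟩ := by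
  subst hi hq
  have hb := edge_target e
  refine PathsFromOne.ext hb.symm (comp_heq rfl rfl (congrArg vtx hb.symm) HEq.rfl ?_)
  exact edgeClass_heq rfl (congrArg _ hb.symm) _ _ (Edge.ext (edge_left e).symm rfl rfl)

theorem appendInvEdge_appendEdge (i : P.rels) (q : FreeGroup X) (x : P.PathsFromOne) :
    appendEdge i q (appendInvEdge i q x) = x := by
  obtain ⟨a, f⟩ := x
  refine (appendEdge_eq _ (edgeTo i q a) i q rfl rfl).trans ?_
  rw [Category.assoc, Groupoid.inv_comp, Category.comp_id]

/-- The end point can be cancelled in `F(X)` and the appended edge in the groupoid. Injectivity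
turns the one-sided inverse `appendInvEdge` into a two-sided one. -/
theorem appendEdge_injective (i : P.rels) (q : FreeGroup X) :
    Function.Injective (appendEdge (P := P) i q) := by
  rintro ⟨a, f⟩ ⟨b, g⟩ h
  have hab : a = b := mul_right_cancel (congrArg Sigma.fst h)
  subst hab
  exact PathsFromOne.ext rfl (heq_of_eq ((cancel_mono _).1 (eq_of_heq (Sigma.mk.inj h).2)))

/-- Appending an edge as a permutation of the paths that start at `1`. -/
def appendPerm (i : P.rels) (q : FreeGroup X) : Equiv.Perm P.PathsFromOne where
  toFun := appendEdge i q
  invFun := appendInvEdge i q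
  left_inv _ := appendEdge_injective i q (appendInvEdge_appendEdge i q _)
  right_inv := appendInvEdge_appendEdge i q

/-- This is the Peiffer relation for appending edges: the two routes are the two sides of a single
2-cell. -/
theorem appendEdge_comm (i j : P.rels) (a b : FreeGroup X) (x : P.PathsFromOne) :
    appendEdge i a (appendEdge j b x) =
      appendEdge j (b * a⁻¹ * relator i * a) (appendEdge i a x) := by
  obtain ⟨c, f⟩ := x
  -- `d` is the end point in the form produced by the second route; `e₂` is the last edge of the
  -- first route, retyped so as to end there.
  let d := c * (a⁻¹ * relator i * a) * ((b * a⁻¹ * relator i * a)⁻¹ * relator j *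
    (b * a⁻¹ * relator i * a))
  let e₂ : (⟨c * (b⁻¹ * relator j * b)⟩ : P.Vertex) ⟶ ⟨d⟩ :=
    ⟨(edgeFrom i a _).1, (edgeFrom i a _).2.1, by
      refine (edgeFrom i a _).2.2.trans ?_
      simp only [d]
      group⟩
  -- With `p' = 1` and `q' = a`, the factor `q = b a⁻¹ (lhs i)⁻¹` is forced by `q p' (lhs i) q' =
  -- b`, and `p` by `p (lhs j) b = c`.
  have h := cell_eq (edgeFrom j b c) e₂ (edgeFrom i a c) (edgeFrom j _ _)
    (c * b⁻¹ * (lhs j)⁻¹) (b * a⁻¹ * (lhs i)⁻¹) 1 a j i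
    (by ext1 <;> simp [edgeFrom]) (by ext1 <;> simp [edgeFrom, e₂, relator, mul_assoc])
    (by ext1 <;> simp [edgeFrom, mul_assoc])
    (by ext1 <;> simp [edgeFrom, relator, mul_assoc])
  change _ = (⟨d, _⟩ : P.PathsFromOne)
  refine (appendEdge_eq _ e₂ i a rfl rfl).trans ?_
  rw [Category.assoc, h, ← Category.assoc]
  rfl

variable (P) in
/-- The action of `C(P)` on the paths that start at `1`: a generator acts by removing an edge. -/
def pathAction : P.C →* Equiv.Perm P.PathsFromOne :=
  -- Appending edges is a right action, as paths compose from left to right; the inverse makes it a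
  -- homomorphism into permutations.
  PresentedGroup.toGroup (f := fun x : P.rels × FreeGroup X => (appendPerm x.1 x.2)⁻¹) (by
    rintro _ ⟨r, s, a, b, rfl⟩
    have h : appendPerm r a * appendPerm s b =
        appendPerm s (b * a⁻¹ * relator r * a) * appendPerm r a :=
      Equiv.ext fun x => appendEdge_comm r s a b x
    simp only [map_mul, map_inv, FreeGroup.lift_apply_of, inv_inv]
    rw [h]
    group)

theorem pathAction_gen (r : P.rels) (a : FreeGroup X) :
    P.pathAction (gen r a) = (appendPerm r a)⁻¹ :=
  PresentedGroup.toGroup.of _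

variable (P) in
/-- The trivial path at `1`. -/
def trivialPath : P.PathsFromOne := ⟨1, 𝟙 _⟩

/-- The inverse of the value of a path rebuilds it edge by edge from the trivial path, so a path
from `1` is determined by its value. -/
theorem pathAction_pathVal {b : FreeGroup X} (f : (vtx 1 : P.FundGpd) ⟶ vtx b) :
    P.pathAction (pathVal f)⁻¹ P.trivialPath = ⟨b, f⟩ := by
  -- The induction on paths needs a free starting vertex, hence an arbitrary prefix `g` from `1` to
  -- that vertex.
  suffices h : ∀ {a b : FreeGroup X} (f : (vtx a : P.FundGpd) ⟶ vtx b)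
      (g : (vtx 1 : P.FundGpd) ⟶ vtx a), P.pathAction (pathVal f)⁻¹ ⟨a, g⟩ = ⟨b, g ≫ f⟩ by
    rw [trivialPath, h, Category.id_comp]
  clear f
  intro a b f
  refine path_induction (Q := fun {a b} f => ∀ g : (vtx 1 : P.FundGpd) ⟶ vtx a,
    P.pathAction (pathVal f)⁻¹ ⟨a, g⟩ = ⟨b, g ≫ f⟩) ?_ ?_ ?_ f
  · intro a g
    rw [pathVal_id, inv_one, map_one, Category.comp_id]
    rfl
  · intro a b c f e hf g
    rw [pathVal_comp, mul_inv_rev, map_mul, Equiv.Perm.mul_apply, hf, pathVal_edge, map_inv,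
      pathAction_gen, inv_inv, ← Category.assoc]
    exact appendEdge_eq _ e _ _ rfl rfl
  · intro a b c f e hf g
    rw [pathVal_comp, mul_inv_rev, map_mul, Equiv.Perm.mul_apply, hf, pathVal_inv, pathVal_edge,
      inv_inv, pathAction_gen, Equiv.Perm.inv_eq_iff_eq, ← Category.assoc]
    refine ((appendEdge_eq _ e _ _ rfl rfl).trans ?_).symm
    rw [Category.assoc, Groupoid.inv_comp, Category.comp_id]

/-- Removing an edge divides the value on the right by its label. Applied to `c⁻¹` and the trivial
path, this yields a path with value `c`. -/
theorem pathVal_pathAction (c : P.C) (x : P.PathsFromOne) :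
    pathVal (P.pathAction c x).2 = pathVal x.2 * c⁻¹ := by
  have hc : c ∈ Subgroup.closure (Set.range (PresentedGroup.of (rels := P.peiffer))) := by
    rw [PresentedGroup.closure_range_of]; trivial
  have key : ∀ (i : P.rels) (q : FreeGroup X) (x : P.PathsFromOne),
      pathVal (appendPerm i q x).2 = pathVal x.2 * gen i q := fun i q x => by
    exact (pathVal_comp _ _).trans (congrArg _ (pathVal_edge (edgeFrom i q x.1)))
  induction hc using Subgroup.closure_induction generalizing x with
  | mem y hy =>
    obtain ⟨⟨r, a⟩, rfl⟩ := hy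
    change pathVal (P.pathAction (gen r a) x).2 = pathVal x.2 * (gen r a)⁻¹
    rw [pathAction_gen, eq_mul_inv_iff_mul_eq, ← key, ← Equiv.Perm.mul_apply, mul_inv_cancel]
    rfl
  | one => rw [map_one, inv_one, mul_one]; rfl
  | mul y z _ _ hy hz => rw [map_mul, Equiv.Perm.mul_apply, hy, hz, mul_inv_rev, mul_assoc]
  | inv y _ hy =>
    -- The induction hypothesis at `y⁻¹ · x` expresses the value of `x` through that of `y⁻¹ · x`,
    -- and can be solved for the latter.
    have h := hy (P.pathAction y⁻¹ x)
    rw [← Equiv.Perm.mul_apply, ← map_mul, mul_inv_cancel, map_one] at h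
    rw [inv_inv, ← mul_inv_eq_iff_eq_mul]
    exact h.symm

/-! ### Closed paths and identities -/

variable (P) in
/-- Reading off elements of `C(P)` identifies the closed paths at `1` with the identities. -/
def loopHom : P.LoopGroup →* P.boundary.ker where
  toFun f := ⟨pathVal f, by rw [MonoidHom.mem_ker, boundary_pathVal, inv_mul_cancel]⟩
  map_one' := Subtype.ext (pathVal_id 1)
  map_mul' f g := Subtype.ext (pathVal_comp f g)

/-- Injectivity is the recovery of a path from its value. For surjectivity, a path from `1` with
value `c` ends at `∂ c`, which is `1` for an identity. -/
theorem loopHom_bijective : Function.Bijective P.loopHom := by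
  constructor
  · intro f g h
    have hv : pathVal f = pathVal g := congrArg Subtype.val h
    have hf := pathAction_pathVal f
    rw [hv, pathAction_pathVal g] at hf
    exact (eq_of_heq (Sigma.mk.inj hf).2).symm
  · rintro ⟨c, hc⟩
    have hv := pathVal_pathAction c⁻¹ P.trivialPath
    generalize P.pathAction c⁻¹ P.trivialPath = x at hv
    obtain ⟨b, f⟩ := x
    have h₁ : pathVal (P.trivialPath).2 = 1 := pathVal_id 1
    rw [h₁, one_mul, inv_inv] at hv
    have hb := boundary_pathVal f
    rw [hv, MonoidHom.mem_ker.1 hc, inv_one, one_mul] at hb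
    subst hb
    exact ⟨f, Subtype.ext hv⟩

/-! ### Modules from actions -/

theorem moduleOfAction_smul {A : Type w} [CommGroup A] (φ : FreeGroup X →* MulAut A)
    (h : ∀ n ∈ P.N, φ n = 1) (u : FreeGroup X) (x : A) :
    letI := P.moduleOfAction φ h
    (MonoidAlgebra.single (P.θ u) 1 : P.ZG) • Additive.ofMul x = Additive.ofMul (φ u x) := by
  change (P.repOfAction φ h).asAlgebraHom (MonoidAlgebra.single (P.θ u) 1) (Additive.ofMul x) = _
  rw [Representation.asAlgebraHom_single_one]
  rfl

/-- An additive map that is equivariant under `F(X)` is `ℤG`-linear. -/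
def linearOfEquivariant {A : Type v} {B : Type w} [AddCommGroup A] [AddCommGroup B]
    [Module P.ZG A] [Module P.ZG B] (f : A →+ B)
    (hf : ∀ (u : FreeGroup X) (x : A), f ((MonoidAlgebra.single (P.θ u) 1 : P.ZG) • x) =
      (MonoidAlgebra.single (P.θ u) 1 : P.ZG) • f x) : A →ₗ[P.ZG] B where
  __ := f
  map_smul' z x := by
    change f (z • x) = z • f x
    induction z using MonoidAlgebra.induction_on with
    | of g =>
      obtain ⟨u, rfl⟩ := QuotientGroup.mk'_surjective P.N g
      exact hf u x
    | add y z hy hz => rw [add_smul, map_add, hy, hz, add_smul]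
    | smul n z hz => rw [smul_assoc, map_zsmul, hz, smul_assoc]

theorem RelationModule.smul_of (u : FreeGroup X) (n : P.N) :
    (MonoidAlgebra.single (P.θ u) 1 : P.ZG) • RelationModule.of P n =
      RelationModule.of P (MulAut.conjNormal u n) :=
  moduleOfAction_smul P.conjAb P.conjAb_eq_one u (Abelianization.of n)

/-! ### The abelianisation of the free crossed module -/

theorem range_boundary : P.boundary.range = P.N := by
  refine le_antisymm ?_ P.N_le_range_boundary
  rw [MonoidHom.range_eq_map, ← PresentedGroup.closure_range_of, MonoidHom.map_closure,
    Subgroup.closure_le]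
  rintro _ ⟨_, ⟨⟨r, a⟩, rfl⟩, rfl⟩
  change P.boundary (gen r a) ∈ P.N
  rw [boundary_gen]
  simpa using Subgroup.Normal.conj_mem inferInstance _ (P.relator_mem r) a⁻¹

variable (P) in
/-- The boundary map with codomain `N`. -/
def boundaryN : P.C →* P.N :=
  P.boundary.codRestrict P.N fun c => P.range_boundary.le ⟨c, rfl⟩

theorem boundaryN_surjective : Function.Surjective P.boundaryN := by
  rintro ⟨n, hn⟩
  obtain ⟨c, rfl⟩ := P.N_le_range_boundary hn
  exact ⟨c, rfl⟩

/-- The boundary map has a section on `N`, since subgroups of free groups are free. -/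
theorem exists_section : ∃ s : P.N →* P.C, ∀ n, P.boundary (s n) = n := by
  have : IsFreeGroup P.N := subgroupIsFreeOfIsFree P.N
  choose t ht using P.boundaryN_surjective
  refine ⟨IsFreeGroup.lift fun x => t (IsFreeGroup.of x), fun n => ?_⟩
  have h : P.boundaryN.comp (IsFreeGroup.lift fun x => t (IsFreeGroup.of x)) =
      MonoidHom.id P.N := by
    refine IsFreeGroup.ext_hom fun x => ?_
    simp [ht]
  exact congrArg Subtype.val (DFunLike.congr_fun h n)

/-- The element `∂ c` acts on `C(P)` as conjugation by `c`, and here it acts trivially. -/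
theorem commute_of_mem_ker {c : P.C} (hc : P.boundary c = 1) (d : P.C) : c * d = d * c := by
  have h := P.actC_boundary c d
  rw [hc, map_one] at h
  exact (eq_mul_inv_iff_mul_eq.1 h).symm

/-- The group `C(P)` retracts onto the kernel of its boundary map. -/
theorem exists_retraction : ∃ π : P.C →* P.boundary.ker, ∀ c : P.boundary.ker, π c = c := by
  obtain ⟨s, hs⟩ := P.exists_section
  have hker : ∀ c, P.boundary (c * (s (P.boundaryN c))⁻¹) = 1 := fun c => by
    rw [map_mul, map_inv, hs]
    exact mul_inv_cancel _
  -- The retraction divides `c` by the section of its boundary.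
  refine ⟨⟨⟨fun c => ⟨c * (s (P.boundaryN c))⁻¹, hker c⟩, ?_⟩, ?_⟩, ?_⟩
  · ext
    simp
  · intro c d
    ext
    -- Multiplicativity rests on centrality: the kernel part of `d` moves past the section part of
    -- `c`.
    have h := commute_of_mem_ker (hker d) (s (P.boundaryN c))⁻¹
    change c * d * (s (P.boundaryN (c * d)))⁻¹ =
      c * (s (P.boundaryN c))⁻¹ * (d * (s (P.boundaryN d))⁻¹)
    rw [mul_assoc c (s _)⁻¹, ← h, map_mul, map_mul]
    group
  · rintro ⟨c, hc⟩
    ext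
    have h : P.boundaryN c = 1 := Subtype.ext hc
    change c * (s (P.boundaryN c))⁻¹ = c
    rw [h, map_one, inv_one, mul_one]

/-! ### The abelianisation of `C(P)` as a free module -/

variable (P) in
/-- The action of `F(X)` on the abelianisation of `C(P)`. -/
def actAb : FreeGroup X →* MulAut (Abelianization P.C) where
  toFun a := (P.actC a).abelianizationCongr
  map_one' := by
    ext x
    induction x using QuotientGroup.induction_on with
    | H c => exact congrArg Abelianization.of (by simp)
  map_mul' a b := by
    ext x
    induction x using QuotientGroup.induction_on with
    | H c => exact congrArg Abelianization.of (by simp)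

theorem actAb_of (a : FreeGroup X) (c : P.C) :
    P.actAb a (Abelianization.of c) = Abelianization.of (P.actC a c) := rfl

/-- Elements of `N` are boundaries, and boundaries act on `C(P)` by inner automorphisms. -/
theorem actAb_eq_one (a : FreeGroup X) (ha : a ∈ P.N) : P.actAb a = 1 := by
  obtain ⟨d, rfl⟩ := P.N_le_range_boundary ha
  ext x
  induction x using QuotientGroup.induction_on with
  | H c =>
    change P.actAb _ (Abelianization.of c) = Abelianization.of c
    rw [actAb_of, actC_boundary, map_mul, map_mul, map_inv, mul_comm, inv_mul_cancel_left]

theorem crossedToFree_gen (r : P.rels) (a : FreeGroup X) :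
    P.crossedToFree (gen r a) = Multiplicative.ofAdd (translate r a) :=
  PresentedGroup.toGroup.of _

/-- The homomorphism `crossedToFree` is the abelianisation of `C(P)`. -/
theorem ker_crossedToFree_le : P.crossedToFree.ker ≤ commutator P.C := by
  let : Module P.ZG (Additive (Abelianization P.C)) := P.moduleOfAction P.actAb P.actAb_eq_one
  -- `L` sends `e_r` to the class of `(r, 1)`, hence `θ(a)⁻¹ e_r` to the class of `(r, a)`. So the
  -- abelianisation map factors through `crossedToFree`.
  let L : P.FreeMod →ₗ[P.ZG] Additive (Abelianization P.C) :=
    Finsupp.linearCombination P.ZG fun r => Additive.ofMul (Abelianization.of (gen r 1))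
  have hL : (AddMonoidHom.toMultiplicativeLeft L.toAddMonoidHom).comp P.crossedToFree =
      Abelianization.of := by
    ext ⟨r, a⟩
    change AddMonoidHom.toMultiplicativeLeft L.toAddMonoidHom (P.crossedToFree (gen r a)) =
      Abelianization.of (gen r a)
    rw [crossedToFree_gen]
    change Additive.toMul (L (translate r a)) = _
    rw [translate, map_smul, basisElt, Finsupp.linearCombination_single, one_smul, ← map_inv,
      moduleOfAction_smul, actAb_of, actC_apply, shift_gen, one_mul, inv_inv]
    rfl
  intro c hc
  rw [← Abelianization.ker_of, MonoidHom.mem_ker, ← hL, MonoidHom.comp_apply,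
    MonoidHom.mem_ker.1 hc, map_one]

/-- The element `θ(u) e_r` is the image of `(r, u⁻¹)`; sums and integer multiples lift to products
and powers. -/
theorem crossedToFree_surjective : Function.Surjective P.crossedToFree := by
  suffices h : ∀ x : P.FreeMod, ∃ c, P.crossedToFree c = Multiplicative.ofAdd x from
    fun x => h x.toAdd
  intro x
  induction x using Finsupp.induction_linear with
  | zero => exact ⟨1, map_one _⟩
  | add x y hx hy =>
    obtain ⟨c, hc⟩ := hx
    obtain ⟨d, hd⟩ := hy
    exact ⟨c * d, by rw [map_mul, hc, hd, ofAdd_add]⟩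
  | single r z =>
    induction z using MonoidAlgebra.induction_on with
    | of g =>
      obtain ⟨u, rfl⟩ := QuotientGroup.mk'_surjective P.N g
      refine ⟨gen r u⁻¹, ?_⟩
      rw [crossedToFree_gen, translate, basisElt, map_inv, inv_inv, Finsupp.smul_single,
        smul_eq_mul, mul_one]
      rfl
    | add y z hy hz =>
      obtain ⟨c, hc⟩ := hy
      obtain ⟨d, hd⟩ := hz
      exact ⟨c * d, by rw [map_mul, hc, hd, Finsupp.single_add, ofAdd_add]⟩
    | smul n z hz =>
      obtain ⟨c, hc⟩ := hz
      exact ⟨c ^ n, by rw [map_zpow, hc, ← ofAdd_zsmul, Finsupp.smul_single]⟩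

/-- Such a `c` is a product of commutators, which the retraction onto the abelian group `ker ∂`
kills; but the retraction fixes `c`. -/
theorem eq_one_of_boundary_of_crossedToFree {c : P.C} (h₁ : P.boundary c = 1)
    (h₂ : P.crossedToFree c = 1) : c = 1 := by
  obtain ⟨π, hπ⟩ := P.exists_retraction
  have hc : Abelianization.of c = 1 := by
    rw [← MonoidHom.mem_ker, Abelianization.ker_of]
    exact ker_crossedToFree_le h₂
  have h := hπ ⟨c, h₁⟩
  rw [← Abelianization.lift_apply_of π, hc, map_one] at h
  exact congrArg Subtype.val h.symm

theorem crossedToFree_actC (u : FreeGroup X) (c : P.C) :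
    (P.crossedToFree (P.actC u c)).toAdd =
      (MonoidAlgebra.single (P.θ u) 1 : P.ZG) • (P.crossedToFree c).toAdd := by
  have h : P.crossedToFree.comp (P.shift u) =
      (AddMonoidHom.toMultiplicative (DistribSMul.toAddMonoidHom P.FreeMod
        (MonoidAlgebra.single (P.θ u) 1 : P.ZG))).comp P.crossedToFree := by
    ext1 ⟨r, a⟩
    change P.crossedToFree (P.shift u (gen r a)) = Multiplicative.ofAdd
      ((MonoidAlgebra.single (P.θ u) 1 : P.ZG) • (P.crossedToFree (gen r a)).toAdd)
    rw [shift_gen, crossedToFree_gen, crossedToFree_gen, toAdd_ofAdd, translate, translate,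
      smul_smul, MonoidAlgebra.single_mul_single, one_mul, map_mul, map_inv, mul_inv_rev, inv_inv]
  exact congrArg Multiplicative.toAdd (DFunLike.congr_fun h c)

/-! ### The maps of the exact sequence -/

variable (P) in
/-- The homomorphism `⨁ ℤG → N^{ab}` that sends `e_r` to the class of the relator of `r`. -/
noncomputable def relationMap : P.FreeMod →ₗ[P.ZG] P.RelationModule :=
  Finsupp.linearCombination P.ZG fun r => RelationModule.of P ⟨relator r, P.relator_mem r⟩

theorem relationMap_basisElt (r : P.rels) :
    P.relationMap (basisElt r) = RelationModule.of P ⟨relator r, P.relator_mem r⟩ := by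
  rw [relationMap, basisElt, Finsupp.linearCombination_single, one_smul]

/-- On generators, `θ(a)⁻¹` acts on the class of the relator by conjugation with `a⁻¹`, which gives
the class of `∂(r, a)`. -/
theorem relationMap_crossedToFree (c : P.C) :
    P.relationMap (P.crossedToFree c).toAdd = RelationModule.of P (P.boundaryN c) := by
  have h : (AddMonoidHom.toMultiplicativeLeft (β := Abelianization P.N)
      P.relationMap.toAddMonoidHom).comp P.crossedToFree =
      Abelianization.of.comp P.boundaryN := by
    ext1 ⟨r, a⟩
    change P.relationMap (P.crossedToFree (gen r a)).toAdd =
      RelationModule.of P (P.boundaryN (gen r a))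
    rw [crossedToFree_gen, toAdd_ofAdd, translate, map_smul, relationMap_basisElt, ← map_inv,
      RelationModule.smul_of]
    refine congrArg _ (Subtype.ext ?_)
    change _ = P.boundary (gen r a)
    rw [boundary_gen, MulAut.conjNormal_apply, inv_inv]
  exact DFunLike.congr_fun h c

theorem relationMap_surjective : Function.Surjective P.relationMap := by
  intro y
  obtain ⟨n, rfl⟩ := QuotientGroup.mk_surjective (s := commutator P.N) y
  obtain ⟨c, rfl⟩ := P.boundaryN_surjective n
  exact ⟨_, relationMap_crossedToFree c⟩

/-- A lift `c` of `x` has boundary in `[N, N]`, the image of `[C(P), C(P)]`. Dividing `c` by a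
product of commutators with the same boundary makes it an identity and leaves its image in the free
module unchanged. -/
theorem exists_identity_of_relationMap_eq_zero {x : P.FreeMod} (hx : P.relationMap x = 0) :
    ∃ c : P.boundary.ker, P.crossedToFree c = Multiplicative.ofAdd x := by
  obtain ⟨c, hc⟩ := P.crossedToFree_surjective (Multiplicative.ofAdd x)
  have h := relationMap_crossedToFree c
  rw [hc, toAdd_ofAdd, hx] at h
  have hn : P.boundaryN c ∈ commutator P.N := by
    rw [← Abelianization.ker_of, MonoidHom.mem_ker]
    exact h.symm
  have hmap : (commutator P.C).map P.boundaryN = commutator P.N := by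
    rw [commutator_def, commutator_def, Subgroup.map_commutator,
      Subgroup.map_top_of_surjective _ P.boundaryN_surjective]
  rw [← hmap] at hn
  obtain ⟨d, hd, hdc⟩ := hn
  have hd' : P.boundary d = P.boundary c := congrArg Subtype.val hdc
  refine ⟨⟨c * d⁻¹, ?_⟩, ?_⟩
  · rw [MonoidHom.mem_ker, map_mul, map_inv, hd', mul_inv_cancel]
  · have h₁ : P.crossedToFree d = 1 :=
      Abelianization.commutator_subset_ker P.crossedToFree hd
    change P.crossedToFree (c * d⁻¹) = _
    rw [map_mul, map_inv, h₁, inv_one, mul_one, hc]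

theorem weight_map {a b : FreeGroup X} (f : (vtx a : P.FundGpd) ⟶ vtx b) :
    P.weight.map f = P.crossedToFree (pathVal f) := by
  have key : ∀ {b c : FreeGroup X} (e : (⟨b⟩ : P.Vertex) ⟶ ⟨c⟩),
      P.weight.map (edgeClass e) = P.crossedToFree (pathVal (edgeClass e)) := by
    intro b c e
    rw [pathVal_edge, crossedToFree_gen]
    exact P.lift_edgeClass _ _ e
  have comp : ∀ {a b c : FreeGroup X} (f : (vtx a : P.FundGpd) ⟶ vtx b)
      (g : (vtx b : P.FundGpd) ⟶ vtx c), P.weight.map f = P.crossedToFree (pathVal f) →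
      P.weight.map g = P.crossedToFree (pathVal g) →
      P.weight.map (f ≫ g) = P.crossedToFree (pathVal (f ≫ g)) := by
    intro a b c f g hf hg
    -- Composition in `SingleObj` reverses products; the target is commutative, so the order does
    -- not matter.
    rw [Functor.map_comp, hf, hg, pathVal_comp, map_mul, mul_comm]
    rfl
  refine path_induction (Q := fun {a b} f => P.weight.map f = P.crossedToFree (pathVal f))
    ?_ ?_ ?_ f
  · intro a
    rw [pathVal_id, map_one]
    exact P.weight.map_id (vtx a)
  · intro a b c f e hf
    exact comp f _ hf (key e)
  · intro a b c f e hf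
    refine comp f _ hf ?_
    rw [pathVal_inv, map_inv, ← key, Groupoid.inv_eq_inv, Functor.map_inv,
      ← Groupoid.inv_eq_inv]
    rfl

variable (P) in
/-- The isomorphism of the fundamental group with the module of identities. -/
noncomputable def pi1Equiv : P.Pi1 ≃ₗ[P.ZG] P.Identities :=
  LinearEquiv.ofBijective
    (linearOfEquivariant (A := P.Pi1) (B := P.Identities) (MonoidHom.toAdditive P.loopHom)
      fun u x => by
        have h₁ : (MonoidAlgebra.single (P.θ u) 1 : P.ZG) • x =
            Additive.ofMul (conjLoop u x.toMul) :=
          moduleOfAction_smul P.actLoop P.actLoop_eq_one u x.toMul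
        have h₂ := moduleOfAction_smul P.actKer P.actKer_eq_one u (P.loopHom x.toMul)
        rw [h₁]
        refine Eq.trans ?_ h₂.symm
        exact congrArg Additive.ofMul (Subtype.ext (pathVal_conjLoop u x.toMul)))
    P.loopHom_bijective

variable (P) in
/-- The restriction of `crossedToFree` to the module of identities. -/
noncomputable def identitiesToFree : P.Identities →ₗ[P.ZG] P.FreeMod :=
  linearOfEquivariant (A := P.Identities)
    (MonoidHom.toAdditiveLeft (P.crossedToFree.comp P.boundary.ker.subtype)) fun u x => by
      have h := moduleOfAction_smul P.actKer P.actKer_eq_one u x.toMul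
      refine Eq.trans (congrArg _ h) ?_
      exact crossedToFree_actC u x.val

theorem identitiesToFree_apply (x : P.Identities) :
    P.identitiesToFree x = (P.crossedToFree x.val).toAdd := rfl

theorem identitiesToFree_injective : Function.Injective P.identitiesToFree := by
  rw [injective_iff_map_eq_zero]
  intro x hx
  exact Subtype.ext (eq_one_of_boundary_of_crossedToFree (MonoidHom.mem_ker.1 x.toMul.2) hx)

theorem exact_identitiesToFree : Function.Exact P.identitiesToFree P.relationMap := by
  intro x
  constructor
  · intro hx
    obtain ⟨c, hc⟩ := exists_identity_of_relationMap_eq_zero hx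
    exact ⟨Additive.ofMul c, hc⟩
  · rintro ⟨y, rfl⟩
    rw [identitiesToFree_apply, relationMap_crossedToFree]
    have h : P.boundaryN y.val = 1 := Subtype.ext (MonoidHom.mem_ker.1 y.toMul.2)
    rw [h]
    rfl

end GroupPresentation

theorem mainTheorem5 {X : Type u} (P : GroupPresentation X) :
    ∃ (ι : P.Pi1 →ₗ[P.ZG] P.FreeMod) (p : P.FreeMod →ₗ[P.ZG] P.RelationModule),
      -- the maps of the sequence
      (∀ x : P.Pi1, ι x = x.weight) ∧
      (∀ r : P.rels, p (GroupPresentation.basisElt r) =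
        GroupPresentation.RelationModule.of P ⟨GroupPresentation.relator r, P.relator_mem r⟩) ∧
      -- exactness
      Function.Injective ι ∧ Function.Exact ι p ∧ Function.Surjective p ∧
      -- the fundamental group is the module of identities
      ∃ e : P.Pi1 ≃ₗ[P.ZG] P.Identities,
        ∀ x : P.Pi1, P.crossedToFree (e x).val = Multiplicative.ofAdd (ι x) := by
  -- Taking `ι` through the identities makes its compatibility with `e` definitional; agreement with
  -- the weight is then `weight_map`.
  refine ⟨P.identitiesToFree ∘ₗ P.pi1Equiv.toLinearMap, P.relationMap, fun x => ?_,
    GroupPresentation.relationMap_basisElt, ?_, ?_, GroupPresentation.relationMap_surjective,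
    P.pi1Equiv, fun x => rfl⟩
  · exact congrArg Multiplicative.toAdd
      (GroupPresentation.weight_map (Additive.toMul (α := P.LoopGroup) x)).symm
  · exact GroupPresentation.identitiesToFree_injective.comp P.pi1Equiv.injective
  · intro y
    rw [GroupPresentation.exact_identitiesToFree y, LinearMap.coe_comp,
      Set.range_comp, LinearEquiv.coe_coe, P.pi1Equiv.surjective.range_eq, Set.image_univ]
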